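/- Let $k\ge 2$ be an integer and let $V$ be a finite set of distinct points of the Euclidean plane. Let $G$ be the unit disk graph on $V$, in which two distinct points are adjacent if and only if their Euclidean distance is at most $1$. Suppose that $G$ is $k$-connected, that is, $|V|\ge k+1$ and $G-S$ is connected for every $S\subseteq V$ with $|S|<k$. The length of a spanning subgraph $F$ of $G$ is $\mathrm{len}(F)=\sum_{uv\in E(F)}\|uv\|$, where $\|uv\|$ is the Euclidean length of the segment $uv$. If $F$ is a $k$-connected spanning subgraph of $G$ of minimum length, i.e. $\mathrm{len}(F)\le \mathrm{len}(H)$ for every $k$-connected spanning subgraph $H$ of $G$, then the maximum degree of $F$ is at most $5k$. -/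

import Mathlib

namespace UDG

/-- The Euclidean plane. -/
abbrev Plane : Type := EuclideanSpace ℝ (Fin 2)

/-- `G` is the unit disk graph of the placement `p` of its nodes in the plane: distinct nodes are
distinct points, and two nodes are adjacent exactly when their distance is at most one. -/
structure IsUnitDiskGraph {V : Type*} (G : SimpleGraph V) (p : V → Plane) : Prop where
  injective : Function.Injective p
  adj_iff : ∀ u v : V, G.Adj u v ↔ u ≠ v ∧ dist (p u) (p v) ≤ 1

/-- Vertex `k`-connectivity of a finite graph: there are more than `k` vertices, and
deleting fewer than `k` vertices never disconnects the graph. -/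
def IsKConnected {V : Type*} [Fintype V] (G : SimpleGraph V) (k : ℕ) : Prop :=
  k < Fintype.card V ∧ ∀ S : Finset V, S.card < k → (G.induce ((S : Set V)ᶜ)).Connected

/-- The Euclidean length of the segment joining the two ends of an edge. -/
noncomputable def edgeLength {V : Type*} (p : V → Plane) : Sym2 V → ℝ :=
  Sym2.lift ⟨fun u v => dist (p u) (p v), fun u v => dist_comm (p u) (p v)⟩

open Classical in
/-- The total Euclidean length of the edges of a graph. -/
noncomputable def len {V : Type*} [Fintype V] (p : V → Plane) (F : SimpleGraph V) : ℝ :=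
  ∑ e ∈ F.edgeFinset, edgeLength p e

/-- `F` is a minimum length `k`-connected spanning subgraph of `G`. A spanning subgraph of `G` is
a graph on the same vertex set all of whose edges are edges of `G`. -/
structure IsKMSS {V : Type*} [Fintype V] (G : SimpleGraph V) (p : V → Plane) (k : ℕ)
    (F : SimpleGraph V) : Prop where
  le : F ≤ G
  connected : IsKConnected F k
  minimal : ∀ H : SimpleGraph V, H ≤ G → IsKConnected H k → len p F ≤ len p H

end UDG

namespace UDG

/-! Fix an edge `uv` of `F`, and let `w ≠ v` be a neighbour of `u` closer to `v` than `u` is.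
Exchanging `uv` for `vw` shortens `F`, so it must destroy `k`-connectivity: fewer than `k` vertices
separate `u` from both `v` and `w` in `F - uv`, or else `w` is itself one of them. Uncrossing gives
a smallest `u`-side serving all such `w` at once, and its separator contains them all. So there are
at most `k - 1` such `w` (`IsKMSS.card_closer_lt`).

The rest is geometry about `u` as origin (`card_le_of_card_closer_le`). A half-open sector of angle
`π / 3` holds at most `k` neighbours, as all of them are close to its farthest one. This alone gives
`6 * k`. Around a farthest neighbour `v`, one ball replaces two sectors, missing at most one point,
a rotation of `v` by `π / 3`. With more than `5 * k` neighbours this point must occur, and iterating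
yields a regular hexagon; three balls at alternate vertices then leave out only the other three, so
there are at most `3 * k + 3 ≤ 5 * k` neighbours. -/

theorem edgeLength_nonneg {V : Type*} (p : V → Plane) (e : Sym2 V) : 0 ≤ edgeLength p e := by
  induction e with
  | _ a b => exact dist_nonneg (x := p a) (y := p b)

theorem exists_adj_of_connected_induce_compl {V : Type*} {F : SimpleGraph V} {S : Finset V}
    (h : (F.induce ((S : Set V)ᶜ)).Connected) {A : Set V} {x y : V} (hx : x ∈ A) (hxS : x ∉ S)
    (hy : y ∉ A) (hyS : y ∉ S) : ∃ a ∈ A, ∃ b, b ∉ A ∧ a ∉ S ∧ b ∉ S ∧ F.Adj a b := by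
  obtain ⟨w⟩ := h.preconnected ⟨x, by simpa using hxS⟩ ⟨y, by simpa using hyS⟩
  obtain ⟨d, -, h1, h2⟩ := w.exists_boundary_dart (Subtype.val ⁻¹' A) hx hy
  exact ⟨d.fst, h1, d.snd, h2, fun hS => d.fst.2 hS, fun hS => d.snd.2 hS, d.adj⟩

/-! ### Separations and their uncrossing -/

section Separation

variable {V : Type*} [DecidableEq V]

/-- `S` separates the part `A`, which contains `u`, from `v`. -/
structure IsSeparation (F : SimpleGraph V) (u v : V) (A S : Finset V) : Prop where
  disjoint : Disjoint A S
  left_mem : u ∈ A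
  right_notMem : v ∉ A
  right_notMem_separator : v ∉ S
  not_adj : ∀ a ∈ A, ∀ b, b ∉ A → b ∉ S → ¬ F.Adj a b

theorem IsSeparation.inter {F : SimpleGraph V} {u v : V} {A S A' S' : Finset V}
    (h : IsSeparation F u v A S) (h' : IsSeparation F u v A' S') :
    IsSeparation F u v (A ∩ A') ((A ∩ S') ∪ (S ∩ A') ∪ (S ∩ S')) := by
  have d := Finset.disjoint_left.1 h.disjoint
  have d' := Finset.disjoint_left.1 h'.disjoint
  have e := h.right_notMem
  have f := h.right_notMem_separator
  refine ⟨?_, ?_, ?_, ?_, ?_⟩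
  · rw [Finset.disjoint_left]
    intro x hx
    have := @d x
    have := @d' x
    simp only [Finset.mem_inter, Finset.mem_union] at hx ⊢
    tauto
  · exact Finset.mem_inter.2 ⟨h.left_mem, h'.left_mem⟩
  · simp [e]
  · simp [e, f]
  · intro a ha b hb hbS hab
    have h1 := fun p q => h.not_adj a (Finset.mem_inter.1 ha).1 b p q hab
    have h2 := fun p q => h'.not_adj a (Finset.mem_inter.1 ha).2 b p q hab
    simp only [Finset.mem_inter, Finset.mem_union] at hb hbS
    tauto

theorem IsSeparation.union {F : SimpleGraph V} {u v : V} {A S A' S' : Finset V}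
    (h : IsSeparation F u v A S) (h' : IsSeparation F u v A' S') :
    IsSeparation F u v (A ∪ A') ((S ∪ S') \ (A ∪ A')) := by
  refine ⟨Finset.disjoint_sdiff, Finset.mem_union_left _ h.left_mem, ?_, ?_, ?_⟩
  · simp [h.right_notMem, h'.right_notMem]
  · simp [h.right_notMem_separator, h'.right_notMem_separator]
  · intro a ha b hb hbS hab
    have h1 := fun s p q => h.not_adj a s b p q hab
    have h2 := fun s p q => h'.not_adj a s b p q hab
    simp only [Finset.mem_sdiff, Finset.mem_union] at ha hb hbS
    tauto

variable [Fintype V]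

/-- Submodularity of separators, here an equality: each vertex counts equally on both sides. -/
theorem IsSeparation.card_inter_add_card_union {F : SimpleGraph V} {u v : V} {A S A' S' : Finset V}
    (h : IsSeparation F u v A S) (h' : IsSeparation F u v A' S') :
    ((A ∩ S') ∪ (S ∩ A') ∪ (S ∩ S')).card + ((S ∪ S') \ (A ∪ A')).card = S.card + S'.card := by
  have d : ∀ x ∈ A, x ∉ S := fun _ hx => Finset.disjoint_left.1 h.disjoint hx
  have d' : ∀ x ∈ A', x ∉ S' := fun _ hx => Finset.disjoint_left.1 h'.disjoint hx
  have key : ∀ T : Finset V, T.card = ∑ x : V, if x ∈ T then 1 else 0 := by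
    intro T; simp
  rw [key, key, key S, key S', ← Finset.sum_add_distrib, ← Finset.sum_add_distrib]
  refine Finset.sum_congr rfl fun x _ => ?_
  have := d x
  have := d' x
  by_cases x ∈ A <;> by_cases x ∈ A' <;> by_cases x ∈ S <;> by_cases x ∈ S' <;> simp_all

/-- Deleting an edge lowers the connectivity by at most one. -/
theorem IsKConnected.le_card_separator_deleteEdges {F : SimpleGraph V} {k : ℕ}
    (hF : IsKConnected F k) {u v : V} {A S : Finset V}
    (h : IsSeparation (F.deleteEdges {s(u, v)}) u v A S) : k ≤ S.card + 1 := by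
  by_contra! hlt
  have hne : ∀ a ∈ A, ∀ b, b ∉ A → b ∉ S → F.Adj a b → a = u ∧ b = v := by
    intro a ha b hb hbS hab
    by_contra hcon
    refine h.not_adj a ha b hb hbS ?_
    rw [SimpleGraph.deleteEdges_adj]
    refine ⟨hab, ?_⟩
    simp only [Set.mem_singleton_iff, Sym2.eq_iff]
    rintro (h1 | ⟨h1, -⟩)
    · exact hcon h1
    · exact h.right_notMem (h1 ▸ ha)
  have d := Finset.disjoint_left.1 h.disjoint
  -- Only `uv` can leave `A` while avoiding `S`, so adding one end of it to `S` disconnects `F`. Add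
  -- `u` if `A` has another vertex; if `A = {u}`, add `v`, and `k < |V|` supplies a vertex on the
  -- far side.
  by_cases hA : ∃ a ∈ A, a ≠ u
  · obtain ⟨x, hx, hxu⟩ := hA
    have hv : v ≠ u := fun e => h.right_notMem (e ▸ h.left_mem)
    obtain ⟨a, ha, b, hb, haS, hbS, hab⟩ := exists_adj_of_connected_induce_compl
      (hF.2 (insert u S) ((Finset.card_insert_le _ _).trans_lt hlt)) (A := A) (x := x) (y := v)
      hx (by simp [hxu, d hx]) h.right_notMem (by simp [hv, h.right_notMem_separator])
    simp only [Finset.mem_insert, not_or] at haS hbS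
    exact haS.1 (hne a ha b hb hbS.2 hab).1
  · push Not at hA
    obtain ⟨y, hy⟩ : ∃ y, y ∉ insert u (insert v S) := by
      by_contra! hall
      have h1 : Fintype.card V ≤ (insert u (insert v S)).card :=
        Finset.card_le_card (s := Finset.univ) fun x _ => hall x
      have h2 := Finset.card_insert_le u (insert v S)
      have h3 := Finset.card_insert_le v S
      have := hF.1
      omega
    simp only [Finset.mem_insert, not_or] at hy
    have hu : u ≠ v := fun e => h.right_notMem (e ▸ h.left_mem)
    obtain ⟨a, ha, b, hb, haS, hbS, hab⟩ := exists_adj_of_connected_induce_compl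
      (hF.2 (insert v S) ((Finset.card_insert_le _ _).trans_lt hlt)) (A := A) (x := u) (y := y)
      h.left_mem (by simp [hu, d h.left_mem]) (fun hyA => hy.1 (hA y hyA)) (by simp [hy])
    simp only [Finset.mem_insert, not_or] at haS hbS
    exact hbS.1 (hne a ha b hb hbS.2 hab).2

/-- If every graph obtained by exchanging the edge `uv` for an edge `vw`, with `w` in a set of
neighbours of `u`, fails to be `k`-connected, then that set has fewer than `k` elements. -/
theorem IsKConnected.card_lt_of_exchange {F : SimpleGraph V} {k : ℕ} (hk : 0 < k)
    (hF : IsKConnected F k) {u v : V} (W : Finset V)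
    (hadj : ∀ w ∈ W, F.Adj u w) (hv : v ∉ W)
    (hW : ∀ w ∈ W, ∃ A S : Finset V, IsSeparation (F.deleteEdges {s(u, v)}) u v A S ∧
      S.card < k ∧ w ∉ A) : W.card < k := by
  classical
  obtain rfl | ⟨w₀, hw₀⟩ := W.eq_empty_or_nonempty
  · simpa
  obtain ⟨A₀, S₀, h₀, hS₀, -⟩ := hW w₀ hw₀
  let P : Finset V → Prop := fun A => ∃ S : Finset V,
    IsSeparation (F.deleteEdges {s(u, v)}) u v A S ∧ S.card < k
  obtain ⟨A, hA, hmin⟩ := Finset.exists_min_image (Finset.univ.filter P) Finset.card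
    ⟨A₀, Finset.mem_filter.2 ⟨Finset.mem_univ _, S₀, h₀, hS₀⟩⟩
  obtain ⟨S, hs, hSk⟩ := (Finset.mem_filter.1 hA).2
  refine (Finset.card_le_card fun w hw => ?_).trans_lt hSk
  obtain ⟨A', S', h', hS', hw'⟩ := hW w hw
  -- The separator of the union has at least `k - 1` vertices, so that of the intersection has at
  -- most `k - 1`.
  have hP : P (A ∩ A') := by
    refine ⟨_, hs.inter h', ?_⟩
    have h1 := hs.card_inter_add_card_union h'
    have h2 := hF.le_card_separator_deleteEdges (hs.union h')
    omega
  have hsub : A ∩ A' = A := Finset.eq_of_subset_of_card_le Finset.inter_subset_left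
    (hmin _ (Finset.mem_filter.2 ⟨Finset.mem_univ _, hP⟩))
  have hwA : w ∉ A := fun hwA => hw' (Finset.mem_inter.1 (hsub ▸ hwA)).2
  by_contra hwS
  refine hs.not_adj u hs.left_mem w hwA hwS ?_
  rw [SimpleGraph.deleteEdges_adj]
  refine ⟨hadj w hw, ?_⟩
  have : w ≠ v := fun e => hv (e ▸ hw)
  have : u ≠ v := fun e => hs.right_notMem (e ▸ hs.left_mem)
  simp_all

/-- If `H - S` joined `u` to `v`, or if `S` contained one of them, every walk of `F - S` could be
rerouted in `H - S`. So `u` and `v` lie in different components of `H - S`, and `A` is that of `u`.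
-/
theorem exists_separation_of_not_isKConnected {F H : SimpleGraph V} {k : ℕ}
    (hF : IsKConnected F k) {u v : V}
    (hle : F.deleteEdges {s(u, v)} ≤ H) (hH : ¬ IsKConnected H k) :
    ∃ A S : Finset V, IsSeparation H u v A S ∧ S.card < k := by
  classical
  obtain ⟨S, hSk, hS⟩ : ∃ S : Finset V, S.card < k ∧ ¬ (H.induce ((S : Set V)ᶜ)).Connected := by
    by_contra! hcon
    exact hH ⟨hF.1, hcon⟩
  have hF' := hF.2 S hSk
  have hadj : ∀ a b, F.Adj a b → ¬ (a = u ∧ b = v) → ¬ (a = v ∧ b = u) → H.Adj a b := by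
    intro a b hab h1 h2
    apply hle
    rw [SimpleGraph.deleteEdges_adj]
    refine ⟨hab, ?_⟩
    simp only [Set.mem_singleton_iff, Sym2.eq_iff]
    tauto
  have hkey : ∀ hreach : ∀ (hu : u ∈ ((S : Set V)ᶜ)) (hv : v ∈ ((S : Set V)ᶜ)),
      (H.induce ((S : Set V)ᶜ)).Reachable ⟨u, hu⟩ ⟨v, hv⟩, False := by
    intro hreach
    refine hS (@SimpleGraph.Connected.mk _ _ ?_ hF'.nonempty)
    intro x y
    obtain ⟨w⟩ := hF'.preconnected x y
    induction w with
    | nil => exact SimpleGraph.Reachable.refl _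
    | @cons a b c hab _ ih =>
      refine SimpleGraph.Reachable.trans ?_ ih
      by_cases h1 : (a : V) = u ∧ (b : V) = v
      · obtain ⟨a, ha⟩ := a
        obtain ⟨b, hb⟩ := b
        obtain ⟨rfl, rfl⟩ := h1
        exact hreach ha hb
      by_cases h2 : (a : V) = v ∧ (b : V) = u
      · obtain ⟨a, ha⟩ := a
        obtain ⟨b, hb⟩ := b
        obtain ⟨rfl, rfl⟩ := h2
        exact (hreach hb ha).symm
      · exact SimpleGraph.Adj.reachable (hadj _ _ hab h1 h2)
  have hex : ∃ (hu : u ∈ ((S : Set V)ᶜ)) (hv : v ∈ ((S : Set V)ᶜ)),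
      ¬ (H.induce ((S : Set V)ᶜ)).Reachable ⟨u, hu⟩ ⟨v, hv⟩ := by
    by_contra! hcon
    exact hkey hcon
  obtain ⟨hu, hv, hnr⟩ := hex
  refine ⟨Finset.univ.filter fun x => ∃ hx : x ∈ ((S : Set V)ᶜ),
    (H.induce ((S : Set V)ᶜ)).Reachable ⟨u, hu⟩ ⟨x, hx⟩, S, ⟨?_, ?_, ?_, ?_, ?_⟩, hSk⟩
  · rw [Finset.disjoint_left]
    intro x hx hxS
    obtain ⟨-, hx', -⟩ := Finset.mem_filter.1 hx
    exact hx' hxS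
  · exact Finset.mem_filter.2 ⟨Finset.mem_univ _, hu, SimpleGraph.Reachable.refl _⟩
  · intro hmem
    obtain ⟨-, hx', h⟩ := Finset.mem_filter.1 hmem
    exact hnr h
  · simpa using hv
  · intro a ha b hb hbS hab
    obtain ⟨-, ha', h⟩ := Finset.mem_filter.1 ha
    have hb' : b ∈ ((S : Set V)ᶜ) := by simpa using hbS
    refine hb (Finset.mem_filter.2 ⟨Finset.mem_univ _, hb', h.trans ?_⟩)
    exact SimpleGraph.Adj.reachable (G := H.induce ((S : Set V)ᶜ)) hab

end Separation

/-! ### Exchanging an edge in a minimum length subgraph -/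

section Exchange

variable {V : Type*} [Fintype V]

theorem len_exchange_le (p : V → Plane) {F : SimpleGraph V} {u v : V} (huv : F.Adj u v) (w : V) :
    len p (F.deleteEdges {s(u, v)} ⊔ SimpleGraph.edge v w) ≤
      len p F - dist (p u) (p v) + dist (p v) (p w) := by
  classical
  have h1 : len p F = dist (p u) (p v) + ∑ e ∈ F.edgeFinset.erase s(u, v), edgeLength p e := by
    have hmem : s(u, v) ∈ F.edgeFinset := SimpleGraph.mem_edgeFinset.2 huv
    unfold len
    rw [← Finset.add_sum_erase _ _ hmem]
    rfl
  have h2 : len p (F.deleteEdges {s(u, v)} ⊔ SimpleGraph.edge v w) ≤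
      ∑ e ∈ insert s(v, w) (F.edgeFinset.erase s(u, v)), edgeLength p e := by
    refine Finset.sum_le_sum_of_subset_of_nonneg ?_ fun e _ _ => edgeLength_nonneg p e
    intro e
    induction e with
    | _ a b =>
      simp only [SimpleGraph.mem_edgeFinset, SimpleGraph.mem_edgeSet, SimpleGraph.sup_adj,
        SimpleGraph.deleteEdges_adj, SimpleGraph.edge_adj, Finset.mem_insert, Finset.mem_erase,
        Set.mem_singleton_iff, Sym2.eq_iff, ne_eq]
      tauto
  have h3 : ∑ e ∈ insert s(v, w) (F.edgeFinset.erase s(u, v)), edgeLength p e ≤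
      dist (p v) (p w) + ∑ e ∈ F.edgeFinset.erase s(u, v), edgeLength p e := by
    -- The edge `vw` may already be present; hence only an inequality.
    by_cases h : s(v, w) ∈ F.edgeFinset.erase s(u, v)
    · rw [Finset.insert_eq_of_mem h]
      linarith [dist_nonneg (x := p v) (y := p w)]
    · rw [Finset.sum_insert h]
      exact le_rfl
  linarith

theorem IsKMSS.card_closer_lt {p : V → Plane} {G F : SimpleGraph V} {k : ℕ}
    (hG : IsUnitDiskGraph G p) (hk : 0 < k) (hF : IsKMSS G p k F) {u v : V} (huv : F.Adj u v)
    (W : Finset V) (hadj : ∀ w ∈ W, F.Adj u w) (hv : v ∉ W)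
    (hlt : ∀ w ∈ W, dist (p v) (p w) < dist (p u) (p v)) : W.card < k := by
  classical
  refine hF.connected.card_lt_of_exchange hk (u := u) W hadj hv fun w hw => ?_
  have hvw : v ≠ w := fun e => hv (e ▸ hw)
  let H := F.deleteEdges {s(u, v)} ⊔ SimpleGraph.edge v w
  have hHG : H ≤ G := by
    refine sup_le ((SimpleGraph.deleteEdges_le _).trans hF.le) ?_
    intro a b hab
    have hGvw : G.Adj v w := (hG.adj_iff v w).2
      ⟨hvw, (hlt w hw).le.trans ((hG.adj_iff u v).1 (hF.le huv)).2⟩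
    rw [SimpleGraph.edge_adj] at hab
    obtain ⟨⟨rfl, rfl⟩ | ⟨rfl, rfl⟩, -⟩ := hab
    · exact hGvw
    · exact hGvw.symm
  have hH : ¬ IsKConnected H k := fun hc => by
    have h1 := hF.minimal H hHG hc
    have h2 := len_exchange_le p huv w
    have h3 := hlt w hw
    linarith
  obtain ⟨A, S, h, hS⟩ := exists_separation_of_not_isKConnected hF.connected (u := u) (v := v)
    (le_sup_left : _ ≤ H) hH
  refine ⟨A, S, ⟨h.disjoint, h.left_mem, h.right_notMem, h.right_notMem_separator, ?_⟩, hS, ?_⟩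
  · exact fun a ha b hb hbS hab => h.not_adj a ha b hb hbS (Or.inl hab)
  -- The new edge `vw` would cross the separation.
  · intro hwA
    refine h.not_adj w hwA v h.right_notMem h.right_notMem_separator (Or.inr ?_)
    rw [SimpleGraph.edge_adj]
    exact ⟨Or.inr ⟨rfl, rfl⟩, hvw.symm⟩

end Exchange

end UDG

/-! ### Planar geometry of the neighbours -/

namespace UDG

/-- Law of cosines: the squared distance is below `‖z‖ ^ 2 + ‖w‖ ^ 2 - ‖z‖ * ‖w‖ ≤ ‖z‖ ^ 2`. -/
theorem dist_lt_norm_of_abs_arg_sub_lt {z w : ℂ} (hw : w ≠ 0) (hle : ‖w‖ ≤ ‖z‖)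
    (harg : |z.arg - w.arg| < Real.pi / 3) : dist z w < ‖z‖ := by
  have hw0 : 0 < ‖w‖ := norm_pos_iff.2 hw
  have hz0 : 0 < ‖z‖ := hw0.trans_le hle
  have hcos : 1 / 2 < Real.cos (z.arg - w.arg) := by
    rw [← Real.cos_abs, ← Real.cos_pi_div_three]
    exact Real.cos_lt_cos_of_nonneg_of_le_pi (abs_nonneg _) (by linarith [Real.pi_pos]) harg
  have hz1 := Complex.norm_mul_cos_arg z
  have hz2 := Complex.norm_mul_sin_arg z
  have hw1 := Complex.norm_mul_cos_arg w
  have hw2 := Complex.norm_mul_sin_arg w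
  have hre : z.re * w.re + z.im * w.im = ‖z‖ * ‖w‖ * Real.cos (z.arg - w.arg) := by
    rw [Real.cos_sub, ← hz1, ← hz2, ← hw1, ← hw2]
    simp only [hz1, hz2, hw1, hw2]
    rw [← hz1, ← hz2, ← hw1, ← hw2]
    ring
  have hsz := Complex.sq_norm z
  have hsw := Complex.sq_norm w
  have hsd := Complex.sq_norm (z - w)
  rw [Complex.normSq_apply] at hsz hsw hsd
  simp only [Complex.sub_re, Complex.sub_im] at hsd
  rw [dist_eq_norm]
  refine lt_of_pow_lt_pow_left₀ 2 hz0.le ?_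
  have h1 : ‖z‖ * ‖w‖ * (1 / 2) < ‖z‖ * ‖w‖ * Real.cos (z.arg - w.arg) :=
    mul_lt_mul_of_pos_left hcos (mul_pos hz0 hw0)
  nlinarith [mul_le_mul_of_nonneg_right hle hw0.le]

theorem dist_mul_left (v z w : ℂ) : dist (v * z) (v * w) = ‖v‖ * dist z w := by
  rw [dist_eq_norm, dist_eq_norm, ← mul_sub, norm_mul]

/-- A half-open sector of opening `π / 3`, in coordinates in which `v` points to `-1`. -/
noncomputable def sector (N : Finset ℂ) (v : ℂ) (α : ℝ) : Finset ℂ :=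
  N.filter fun w => α ≤ (-(w / v)).arg ∧ (-(w / v)).arg < α + Real.pi / 3

theorem card_sector_le {N : Finset ℂ} {k : ℕ} (h0 : 0 ∉ N)
    (hN : ∀ v ∈ N, (N.filter fun w => dist v w < ‖v‖).card ≤ k) {v : ℂ} (hv : v ≠ 0) (α : ℝ) :
    (sector N v α).card ≤ k := by
  obtain h | h := (sector N v α).eq_empty_or_nonempty
  · simp [h]
  obtain ⟨x, hx, hmax⟩ := Finset.exists_max_image _ (fun w : ℂ => ‖w‖) h
  have hx' := Finset.mem_filter.1 hx
  refine (Finset.card_le_card fun w hw => ?_).trans (hN x hx'.1)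
  have hw' := Finset.mem_filter.1 hw
  refine Finset.mem_filter.2 ⟨hw'.1, ?_⟩
  have hw0 : w ≠ 0 := fun e => h0 (e ▸ hw'.1)
  have hv0 : 0 < ‖v‖ := norm_pos_iff.2 hv
  have h1 : dist (-(x / v)) (-(w / v)) < ‖-(x / v)‖ := by
    refine dist_lt_norm_of_abs_arg_sub_lt (by simp [hw0, hv]) ?_ ?_
    · rw [norm_neg, norm_neg, norm_div, norm_div]
      exact div_le_div_of_nonneg_right (hmax w hw) hv0.le
    · rw [abs_lt]
      constructor <;> linarith [hw'.2.1, hw'.2.2, hx'.2.1, hx'.2.2]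
  rw [dist_neg_neg, norm_neg, norm_div, lt_div_iff₀ hv0, mul_comm, ← dist_mul_left] at h1
  simpa [mul_div_cancel₀, hv] using h1

/-- The rotation by `-π / 3`. -/
noncomputable def sixthRoot : ℂ := ⟨1 / 2, -(√3 / 2)⟩

theorem norm_sixthRoot : ‖sixthRoot‖ = 1 := by
  rw [← sq_eq_sq₀ (norm_nonneg _) zero_le_one, Complex.sq_norm, Complex.normSq_apply]
  simp only [sixthRoot]
  nlinarith [Real.sq_sqrt (show (0 : ℝ) ≤ 3 by norm_num)]

/-- The negation moves the branch cut of `arg` to the direction of `1`. The half-open sectors leave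
just one boundary ray here, which meets the unit circle at `sixthRoot`. -/
theorem mem_farthest_or_sector {z : ℂ} (hz : z ≠ 0) (hle : ‖z‖ ≤ 1)
    (harg : (-z).arg < -(2 * Real.pi / 3) ∨ 2 * Real.pi / 3 ≤ (-z).arg) :
    dist 1 z < 1 ∨ z = sixthRoot := by
  have hz0 : 0 < ‖z‖ := norm_pos_iff.2 hz
  have hpi := Real.pi_pos
  have hc : Real.cos (2 * Real.pi / 3) = -(1 / 2) := by
    rw [show 2 * Real.pi / 3 = Real.pi - Real.pi / 3 by ring, Real.cos_pi_sub,
      Real.cos_pi_div_three]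
  have hs : Real.sin (2 * Real.pi / 3) = √3 / 2 := by
    rw [show 2 * Real.pi / 3 = Real.pi - Real.pi / 3 by ring, Real.sin_pi_sub,
      Real.sin_pi_div_three]
  have h1 := Complex.norm_mul_cos_arg (-z)
  have h2 := Complex.norm_mul_sin_arg (-z)
  rw [norm_neg, Complex.neg_re] at h1
  rw [norm_neg, Complex.neg_im] at h2
  have hsz := Complex.sq_norm z
  have hsd := Complex.sq_norm (1 - z)
  rw [Complex.normSq_apply] at hsz hsd
  simp only [Complex.sub_re, Complex.sub_im, Complex.one_re, Complex.one_im] at hsd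
  have hlt : ‖1 - z‖ ^ 2 < 1 → dist 1 z < 1 := by
    intro h
    rw [dist_eq_norm]
    exact lt_of_pow_lt_pow_left₀ 2 zero_le_one (by simpa using h)
  by_cases heq : (-z).arg = 2 * Real.pi / 3
  · rw [heq, hc] at h1
    rw [heq, hs] at h2
    by_cases hn : ‖z‖ = 1
    · right
      rw [hn] at h1 h2
      apply Complex.ext
      · simp only [sixthRoot]; linarith
      · simp only [sixthRoot]; linarith
    · left
      have : ‖z‖ < 1 := lt_of_le_of_ne hle hn
      apply hlt
      nlinarith
  · left
    apply hlt
    have hcos : Real.cos (-z).arg < -(1 / 2) := by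
      rw [← Real.cos_abs, ← hc]
      refine Real.cos_lt_cos_of_nonneg_of_le_pi (by positivity) (Complex.abs_arg_le_pi _) ?_
      rw [lt_abs]
      rcases harg with h | h
      · right; linarith
      · left; exact lt_of_le_of_ne h (Ne.symm heq)
    have := mul_lt_mul_of_pos_left hcos hz0
    nlinarith

theorem mul_sixthRoot_mem {N : Finset ℂ} {k : ℕ} (h0 : 0 ∉ N)
    (hN : ∀ v ∈ N, (N.filter fun w => dist v w < ‖v‖).card ≤ k) (hcard : 5 * k < N.card)
    {v : ℂ} (hv : v ∈ N) (hmax : ∀ w ∈ N, ‖w‖ ≤ ‖v‖) : v * sixthRoot ∈ N := by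
  by_contra hnot
  have hv' : v ≠ 0 := fun e => h0 (e ▸ hv)
  have hv0 : 0 < ‖v‖ := norm_pos_iff.2 hv'
  have hcover : N ⊆ (N.filter fun w => dist v w < ‖v‖) ∪
      (sector N v (-(2 * Real.pi / 3)) ∪ sector N v (-(Real.pi / 3)) ∪
        (sector N v 0 ∪ sector N v (Real.pi / 3))) := by
    intro w hw
    have hw0 : w ≠ 0 := fun e => h0 (e ▸ hw)
    have hvw : v * (w / v) = w := mul_div_cancel₀ _ hv'
    have hfar := mem_farthest_or_sector (z := w / v) (div_ne_zero hw0 hv')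
      (by rw [norm_div]; exact div_le_one_of_le₀ (hmax w hw) hv0.le)
    have hd : dist 1 (w / v) < 1 → dist v w < ‖v‖ := by
      intro h
      have := dist_mul_left v 1 (w / v)
      rw [hvw, mul_one] at this
      rw [this]
      exact mul_lt_of_lt_one_right hv0 h
    have hs : w / v ≠ sixthRoot := by
      intro h
      rw [h] at hvw
      exact hnot (hvw ▸ hw)
    simp only [sector, Finset.mem_union, Finset.mem_filter, hw, true_and]
    generalize (-(w / v)).arg = θ at *
    by_cases h1 : θ < -(2 * Real.pi / 3)
    · exact Or.inl (hd ((hfar (Or.inl h1)).resolve_right hs))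
    by_cases h2 : 2 * Real.pi / 3 ≤ θ
    · exact Or.inl (hd ((hfar (Or.inr h2)).resolve_right hs))
    right
    push Not at h1 h2
    rcases lt_or_ge θ (-(Real.pi / 3)) with h3 | h3
    · left; left; constructor <;> linarith
    rcases lt_or_ge θ 0 with h4 | h4
    · left; right; constructor <;> linarith
    right
    rcases lt_or_ge θ (Real.pi / 3) with h5 | h5
    · left; constructor <;> linarith
    · right; constructor <;> linarith
  have h1 := Finset.card_le_card hcover
  have hs := fun α => card_sector_le h0 hN hv' α
  have h2 := Finset.card_union_le (N.filter fun w => dist v w < ‖v‖)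
      (sector N v (-(2 * Real.pi / 3)) ∪ sector N v (-(Real.pi / 3)) ∪
        (sector N v 0 ∪ sector N v (Real.pi / 3)))
  have h3 := Finset.card_union_le (sector N v (-(2 * Real.pi / 3)) ∪ sector N v (-(Real.pi / 3)))
        (sector N v 0 ∪ sector N v (Real.pi / 3))
  have h4 := Finset.card_union_le (sector N v (-(2 * Real.pi / 3))) (sector N v (-(Real.pi / 3)))
  have h5 := Finset.card_union_le (sector N v 0) (sector N v (Real.pi / 3))
  have := hN v hv
  have := hs (-(2 * Real.pi / 3))
  have := hs (-(Real.pi / 3))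
  have := hs 0
  have := hs (Real.pi / 3)
  omega

theorem re_eq_of_le {a b : ℝ} (hb : 0 ≤ b) (hpos : 0 < a ^ 2 + b ^ 2) (hle : a ^ 2 + b ^ 2 ≤ 1)
    (h1 : 2 * a ≤ a ^ 2 + b ^ 2) (h2 : -a + √3 * b ≤ a ^ 2 + b ^ 2) :
    (a = 1 / 2 ∧ b = √3 / 2) ∨ (a = -1 ∧ b = 0) := by
  have h3 : √3 * √3 = 3 := Real.mul_self_sqrt (by norm_num)
  have hb' : 0 ≤ √3 * b := by positivity
  obtain ⟨s, hs⟩ : ∃ s, a ^ 2 + b ^ 2 = s := ⟨_, rfl⟩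
  rw [hs] at hpos hle h1 h2
  have h5 : (√3 * b) ^ 2 ≤ (s + a) ^ 2 := pow_le_pow_left₀ hb' (by linarith) 2
  have h6 : (√3 * b) ^ 2 = 3 * b ^ 2 := by rw [mul_pow, pow_two √3, h3]
  have h7 : 0 ≤ (s - 2 * a) * (a + s) := mul_nonneg (by linarith) (by linarith)
  -- `h5` plus twice `h7` gives `3 * s ≤ 3 * s ^ 2`; equality then forces `h7` to be tight.
  have h8 : s = 1 := by nlinarith
  subst h8
  have h9 : (1 - 2 * a) * (a + 1) = 0 := by nlinarith
  rcases mul_eq_zero.1 h9 with h | h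
  · left
    have ha : a = 1 / 2 := by linarith
    subst ha
    refine ⟨rfl, ?_⟩
    nlinarith
  · right
    have ha : a = -1 := by linarith
    subst ha
    refine ⟨rfl, ?_⟩
    nlinarith

theorem dist_sixthRoot_lt {z : ℂ} (hz : z ≠ 0) (hle : ‖z‖ ≤ 1) :
    (dist 1 z < 1 ∨ dist (sixthRoot ^ 2) z < 1 ∨ dist (sixthRoot ^ 4) z < 1) ∨
      z = sixthRoot ∨ z = sixthRoot ^ 3 ∨ z = sixthRoot ^ 5 := by
  have h3 : √3 * √3 = 3 := Real.mul_self_sqrt (by norm_num)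
  have p2 : sixthRoot ^ 2 = ⟨-(1 / 2), -(√3 / 2)⟩ := by
    rw [pow_two]
    apply Complex.ext <;> simp only [sixthRoot, Complex.mul_re, Complex.mul_im] <;> nlinarith
  have p3 : sixthRoot ^ 3 = ⟨-1, 0⟩ := by
    rw [pow_succ, p2]
    apply Complex.ext <;> simp only [sixthRoot, Complex.mul_re, Complex.mul_im] <;> nlinarith
  have p4 : sixthRoot ^ 4 = ⟨-(1 / 2), √3 / 2⟩ := by
    rw [pow_succ, p3]
    apply Complex.ext <;> simp only [sixthRoot, Complex.mul_re, Complex.mul_im] <;> nlinarith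
  have p5 : sixthRoot ^ 5 = ⟨1 / 2, √3 / 2⟩ := by
    rw [pow_succ, p4]
    apply Complex.ext <;> simp only [sixthRoot, Complex.mul_re, Complex.mul_im] <;> nlinarith
  obtain ⟨a, b⟩ := z
  have hle' : a ^ 2 + b ^ 2 ≤ 1 := by
    have := pow_le_pow_left₀ (norm_nonneg _) hle 2
    rw [Complex.sq_norm, Complex.normSq_apply] at this
    simp only at this
    linarith
  have hpos : 0 < a ^ 2 + b ^ 2 := by
    have := Complex.normSq_pos.2 hz
    rw [Complex.normSq_apply] at this
    simp only at this
    linarith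
  have hd : ∀ x y : ℝ, x ^ 2 + y ^ 2 = 1 → 1 ≤ dist (⟨x, y⟩ : ℂ) ⟨a, b⟩ →
      2 * (x * a + y * b) ≤ a ^ 2 + b ^ 2 := by
    intro x y hxy h
    rw [dist_eq_norm] at h
    have := pow_le_pow_left₀ zero_le_one h 2
    rw [Complex.sq_norm, Complex.normSq_apply] at this
    simp only [Complex.sub_re, Complex.sub_im] at this
    nlinarith
  by_contra! hcon
  obtain ⟨⟨c1, c2, c3⟩, d1, d2, d3⟩ := hcon
  rw [p2] at c2
  rw [p4] at c3
  rw [p3] at d2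
  rw [p5] at d3
  have e1 := hd 1 0 (by norm_num) c1
  have e2 := hd _ _ (by nlinarith) c2
  have e3 := hd _ _ (by nlinarith) c3
  rcases le_total 0 b with hb | hb
  · rcases re_eq_of_le hb hpos hle' (by linarith) (by linarith) with ⟨rfl, rfl⟩ | ⟨rfl, rfl⟩
    · exact d3 rfl
    · exact d2 rfl
  -- Reflection in the real axis swaps `sixthRoot ^ 2` and `sixthRoot ^ 4`.
  · rcases re_eq_of_le (a := a) (b := -b) (by linarith) (by rwa [neg_sq]) (by rwa [neg_sq])
      (by rw [neg_sq]; linarith) (by rw [neg_sq]; linarith) with ⟨rfl, h⟩ | ⟨rfl, h⟩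
    · obtain rfl : b = -(√3 / 2) := by linarith
      exact d1 rfl
    · obtain rfl : b = 0 := by linarith
      exact d2 rfl

/-- A finite set of nonzero points, each of which has at most `k` points (itself included) closer to
it than the origin, has at most `5 * k` points. -/
theorem card_le_of_card_closer_le {N : Finset ℂ} {k : ℕ} (hk : 2 ≤ k) (h0 : 0 ∉ N)
    (hN : ∀ v ∈ N, (N.filter fun w => dist v w < ‖v‖).card ≤ k) : N.card ≤ 5 * k := by
  by_contra! hcard
  have hne : N.Nonempty := Finset.card_pos.1 (by omega)
  obtain ⟨v, hv, hmax⟩ := Finset.exists_max_image N (fun w : ℂ => ‖w‖) hne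
  have hv' : v ≠ 0 := fun e => h0 (e ▸ hv)
  have hv0 : 0 < ‖v‖ := norm_pos_iff.2 hv'
  have hnorm : ∀ n : ℕ, ‖v * sixthRoot ^ n‖ = ‖v‖ := by
    intro n
    rw [norm_mul, norm_pow, norm_sixthRoot, one_pow, mul_one]
  have hmem : ∀ n : ℕ, v * sixthRoot ^ n ∈ N := by
    intro n
    induction n with
    | zero => simpa using hv
    | succ n ih =>
      rw [pow_succ, ← mul_assoc]
      exact mul_sixthRoot_mem h0 hN hcard ih fun w hw => by rw [hnorm]; exact hmax w hw
  let B : ℕ → Finset ℂ := fun n => N.filter fun w => dist (v * sixthRoot ^ n) w < ‖v‖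
  have hB : ∀ n, (B n).card ≤ k := by
    intro n
    have := hN _ (hmem n)
    rwa [hnorm] at this
  have hcover : N ⊆ (B 0 ∪ (B 2 ∪ B 4)) ∪
      {v * sixthRoot, v * sixthRoot ^ 3, v * sixthRoot ^ 5} := by
    intro w hw
    have hw0 : w ≠ 0 := fun e => h0 (e ▸ hw)
    have hvw : v * (w / v) = w := mul_div_cancel₀ _ hv'
    have hd : ∀ n, dist (sixthRoot ^ n) (w / v) < 1 → w ∈ B n := by
      intro n h
      refine Finset.mem_filter.2 ⟨hw, ?_⟩
      have := dist_mul_left v (sixthRoot ^ n) (w / v)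
      rw [hvw] at this
      rw [this]
      exact mul_lt_of_lt_one_right hv0 h
    have he : ∀ y, w / v = y → w = v * y := by
      rintro y rfl
      exact hvw.symm
    simp only [Finset.mem_union, Finset.mem_insert, Finset.mem_singleton]
    rcases dist_sixthRoot_lt (div_ne_zero hw0 hv')
      (by rw [norm_div]; exact div_le_one_of_le₀ (hmax w hw) hv0.le) with (h | h | h) | h | h | h
    · exact Or.inl (Or.inl (hd 0 (by simpa using h)))
    · exact Or.inl (Or.inr (Or.inl (hd 2 h)))
    · exact Or.inl (Or.inr (Or.inr (hd 4 h)))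
    · exact Or.inr (Or.inl (he _ h))
    · exact Or.inr (Or.inr (Or.inl (he _ h)))
    · exact Or.inr (Or.inr (Or.inr (he _ h)))
  have h1 := Finset.card_le_card hcover
  have h2 := Finset.card_union_le (B 0 ∪ (B 2 ∪ B 4))
    {v * sixthRoot, v * sixthRoot ^ 3, v * sixthRoot ^ 5}
  have h3 := Finset.card_union_le (B 0) (B 2 ∪ B 4)
  have h4 := Finset.card_union_le (B 2) (B 4)
  have h5 : ({v * sixthRoot, v * sixthRoot ^ 3, v * sixthRoot ^ 5} : Finset ℂ).card ≤ 3 :=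
    Finset.card_le_three
  have := hB 0
  have := hB 2
  have := hB 4
  omega

/-! ### The degree bound -/

theorem IsKMSS.degree_le {V : Type*} [Fintype V] {p : V → Plane} {G F : SimpleGraph V} {k : ℕ}
    [DecidableRel F.Adj] (hG : IsUnitDiskGraph G p) (hk : 2 ≤ k) (hF : IsKMSS G p k F) (u : V) :
    F.degree u ≤ 5 * k := by
  classical
  let e : Plane ≃ₗᵢ[ℝ] ℂ := Complex.orthonormalBasisOneI.repr.symm
  let q : V → ℂ := fun v => e (p v - p u)
  have hq : Function.Injective q := fun a b h =>
    hG.injective (sub_left_injective (e.injective h))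
  have hqd : ∀ a b, dist (q a) (q b) = dist (p a) (p b) := by
    intro a b
    rw [e.dist_map, dist_sub_right]
  have hqn : ∀ a, ‖q a‖ = dist (p u) (p a) := by
    intro a
    rw [e.norm_map, dist_comm, dist_eq_norm]
  rw [← SimpleGraph.card_neighborFinset_eq_degree, ← Finset.card_image_of_injective _ hq]
  refine card_le_of_card_closer_le hk ?_ ?_
  · intro h
    obtain ⟨v, hv, hv0⟩ := Finset.mem_image.1 h
    have h1 := hqn v
    rw [hv0, norm_zero] at h1
    exact ((F.mem_neighborFinset u v).1 hv).ne (hG.injective (dist_eq_zero.1 h1.symm))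
  · intro x hx
    obtain ⟨v, hv, rfl⟩ := Finset.mem_image.1 hx
    rw [Finset.filter_image, Finset.card_image_of_injective _ hq]
    simp only [hqd, hqn]
    have huv := (F.mem_neighborFinset u v).1 hv
    -- The ball around `v` contains `v` itself, so fewer than `k` others means at most `k` in all.
    have h1 := hF.card_closer_lt hG (by omega) huv
      (((F.neighborFinset u).filter fun w => dist (p v) (p w) < dist (p u) (p v)).erase v)
      (fun w hw => by simpa using (Finset.mem_filter.1 (Finset.mem_of_mem_erase hw)).1)
      (Finset.notMem_erase _ _)
      (fun w hw => (Finset.mem_filter.1 (Finset.mem_of_mem_erase hw)).2)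
    have h2 := Finset.pred_card_le_card_erase (a := v)
      (s := (F.neighborFinset u).filter fun w => dist (p v) (p w) < dist (p u) (p v))
    omega

end UDG

theorem lemma2 {V : Type*} [Fintype V] (p : V → UDG.Plane) (G : SimpleGraph V)
    (hG : UDG.IsUnitDiskGraph G p) (k : ℕ) (hk : 2 ≤ k) (hGk : UDG.IsKConnected G k)
    (F : SimpleGraph V) [DecidableRel F.Adj] (hF : UDG.IsKMSS G p k F) :
    F.maxDegree ≤ 5 * k :=
  F.maxDegree_le_of_forall_degree_le (5 * k) (hF.degree_le hG hk)
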